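/- Manifolds (finite-dimensional, without boundary), metrics and maps are smooth. For a map $f:(M,g)\to(N,h)$ between Riemannian manifolds, let $\nabla^f$ be the connection induced on $f^{-1}TN$ by the Levi-Civita connection of $h$, let $$\tau(f)=\operatorname{Trace}_g\nabla\,\mathrm{d}f=\sum_i\bigl\{\nabla^f_{e_i}\mathrm{d}f(e_i)-\mathrm{d}f(\nabla^M_{e_i}e_i)\bigr\}$$ be its tension field, and let $$\tau^2(f)=\operatorname{Trace}_g\bigl(\nabla^f\nabla^f-\nabla^f_{\nabla^M}\bigr)\tau(f)-\operatorname{Trace}_g R^N(\mathrm{d}f,\tau(f))\,\mathrm{d}f$$ be its bitension field, where $(e_i)$ is a local orthonormal frame and $R^N(X,Y)Z=[\nabla^N_X,\nabla^N_Y]Z-\nabla^N_{[X,Y]}Z$. The map $f$ is harmonic if $\tau(f)\equiv 0$, biharmonic if $\tau^2(f)\equiv 0$ (the Euler–Lagrange equation of the bienergy $\frac12\int|\tau(f)|^2$), and proper biharmonic if it is biharmonic but not harmonic. **Theorem.** Let $\varphi:(M,g)\to(N_1,h_1)$ and $\psi:(M,g)\to(N_2,h_2)$ be two maps between Riemannian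 manifolds. Then the map $\phi:(M,g)\to(N_1\times N_2,h_1\times h_2)$, $\phi(x)=(\varphi(x),\psi(x))$, into the Riemannian product is biharmonic if and only if both $\varphi$ and $\psi$ are biharmonic. Furthermore, if one of $\varphi$ and $\psi$ is harmonic and the other is proper biharmonic, then $\phi$ is proper biharmonic. -/

import Mathlib

open scoped Manifold ContDiff Topology
open Bundle

noncomputable section

namespace BiharmonicMaps

/-! ## Bilinear forms -/

/-- The pullback `(u, v) ↦ B (A u) (A v)` of a bilinear form along a linear map. -/
def pullbackForm {V W : Type*}
    [AddCommGroup V] [Module ℝ V] [TopologicalSpace V] [IsTopologicalAddGroup V]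
    [ContinuousSMul ℝ V]
    [AddCommGroup W] [Module ℝ W] [TopologicalSpace W] [IsTopologicalAddGroup W]
    [ContinuousSMul ℝ W]
    (B : V →L[ℝ] V →L[ℝ] ℝ) (A : W →L[ℝ] V) : W →L[ℝ] W →L[ℝ] ℝ :=
  (ContinuousLinearMap.precomp ℝ A).comp (B.comp A)

theorem pullbackForm_apply {V W : Type*}
    [AddCommGroup V] [Module ℝ V] [TopologicalSpace V] [IsTopologicalAddGroup V]
    [ContinuousSMul ℝ V]
    [AddCommGroup W] [Module ℝ W] [TopologicalSpace W] [IsTopologicalAddGroup W]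
    [ContinuousSMul ℝ W]
    (B : V →L[ℝ] V →L[ℝ] ℝ) (A : W →L[ℝ] V) (u v : W) :
    pullbackForm B A u v = B (A u) (A v) := rfl

theorem contMDiff_pullbackForm {V W : Type*} [NormedAddCommGroup V] [NormedSpace ℝ V]
    [NormedAddCommGroup W] [NormedSpace ℝ W] (A : W →L[ℝ] V) :
    ContMDiff 𝓘(ℝ, V →L[ℝ] V →L[ℝ] ℝ) 𝓘(ℝ, W →L[ℝ] W →L[ℝ] ℝ) ∞
      (fun B : V →L[ℝ] V →L[ℝ] ℝ ↦ pullbackForm B A) := by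
  have h : ContDiff ℝ ∞ (fun B : V →L[ℝ] V →L[ℝ] ℝ ↦ pullbackForm B A) := by
    unfold pullbackForm
    fun_prop
  exact h.contMDiff

/-- A bilinear form on a tangent space, read in the trivialization given by the chart at `x₀`. -/
theorem trivializationAt_form_apply
    {E : Type*} [NormedAddCommGroup E] [NormedSpace ℝ E]
    {H : Type*} [TopologicalSpace H] {I : ModelWithCorners ℝ E H}
    {M : Type*} [TopologicalSpace M] [ChartedSpace H M] [IsManifold I ∞ M]
    (x₀ x : M) (hx : x ∈ (chartAt H x₀).source)
    (B : TangentSpace I x →L[ℝ] TangentSpace I x →L[ℝ] ℝ) (u v : E) :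
    (trivializationAt (E →L[ℝ] E →L[ℝ] ℝ)
      (fun y : M ↦ TangentSpace I y →L[ℝ] TangentSpace I y →L[ℝ] ℝ) x₀ ⟨x, B⟩).2 u v =
    B (mfderivWithin 𝓘(ℝ, E) I (extChartAt I x₀).symm (Set.range I) (extChartAt I x₀ x) u)
      (mfderivWithin 𝓘(ℝ, E) I (extChartAt I x₀).symm (Set.range I) (extChartAt I x₀ x) v) := by
  rw [← TangentBundle.symmL_trivializationAt hx]
  have hb : x ∈ (trivializationAt E (TangentSpace I : M → Type _) x₀).baseSet := hx
  simp [hom_trivializationAt_apply, ContinuousLinearMap.inCoordinates, hx]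
  rfl

theorem inner_self_nonneg
    {E : Type*} [NormedAddCommGroup E] [NormedSpace ℝ E]
    {H : Type*} [TopologicalSpace H] {I : ModelWithCorners ℝ E H}
    {M : Type*} [TopologicalSpace M] [ChartedSpace H M] [IsManifold I ∞ M]
    (g : ContMDiffRiemannianMetric I ∞ E (TangentSpace I : M → Type _)) (x : M)
    (v : TangentSpace I x) : 0 ≤ g.inner x v v := by
  by_cases h : v = 0
  · rw [h]; simp
  · exact (g.pos x v h).le

/-! ## The Riemannian product of two Riemannian manifolds -/

section ProductMetric

variable
  {F₁ : Type*} [NormedAddCommGroup F₁] [NormedSpace ℝ F₁]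
  {H₁ : Type*} [TopologicalSpace H₁] {J₁ : ModelWithCorners ℝ F₁ H₁}
  {N₁ : Type*} [TopologicalSpace N₁] [ChartedSpace H₁ N₁] [IsManifold J₁ ∞ N₁]
  {F₂ : Type*} [NormedAddCommGroup F₂] [NormedSpace ℝ F₂]
  {H₂ : Type*} [TopologicalSpace H₂] {J₂ : ModelWithCorners ℝ F₂ H₂}
  {N₂ : Type*} [TopologicalSpace N₂] [ChartedSpace H₂ N₂] [IsManifold J₂ ∞ N₂]

/-- The product tensor `π₁^* h₁ + π₂^* h₂` on `N₁ × N₂`. -/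
def prodInner
    (h₁ : ContMDiffRiemannianMetric J₁ ∞ F₁ (TangentSpace J₁ : N₁ → Type _))
    (h₂ : ContMDiffRiemannianMetric J₂ ∞ F₂ (TangentSpace J₂ : N₂ → Type _)) (p : N₁ × N₂) :
    TangentSpace (J₁.prod J₂) p →L[ℝ] TangentSpace (J₁.prod J₂) p →L[ℝ] ℝ :=
  pullbackForm (h₁.inner p.1) (mfderiv (J₁.prod J₂) J₁ Prod.fst p) +
    pullbackForm (h₂.inner p.2) (mfderiv (J₁.prod J₂) J₂ Prod.snd p)

theorem prodInner_apply
    (h₁ : ContMDiffRiemannianMetric J₁ ∞ F₁ (TangentSpace J₁ : N₁ → Type _))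
    (h₂ : ContMDiffRiemannianMetric J₂ ∞ F₂ (TangentSpace J₂ : N₂ → Type _)) (p : N₁ × N₂)
    (u v : F₁ × F₂) :
    prodInner h₁ h₂ p u v = h₁.inner p.1 u.1 v.1 + h₂.inner p.2 u.2 v.2 := by
  have e1 : mfderiv (J₁.prod J₂) J₁ Prod.fst p = ContinuousLinearMap.fst ℝ F₁ F₂ := mfderiv_fst
  have e2 : mfderiv (J₁.prod J₂) J₂ Prod.snd p = ContinuousLinearMap.snd ℝ F₁ F₂ := mfderiv_snd
  change h₁.inner p.1 (mfderiv (J₁.prod J₂) J₁ Prod.fst p u)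
      (mfderiv (J₁.prod J₂) J₁ Prod.fst p v) +
    h₂.inner p.2 (mfderiv (J₁.prod J₂) J₂ Prod.snd p u)
      (mfderiv (J₁.prod J₂) J₂ Prod.snd p v) = _
  rw [e1, e2]
  rfl

theorem contMDiff_prodInner
    (h₁ : ContMDiffRiemannianMetric J₁ ∞ F₁ (TangentSpace J₁ : N₁ → Type _))
    (h₂ : ContMDiffRiemannianMetric J₂ ∞ F₂ (TangentSpace J₂ : N₂ → Type _)) :
    ContMDiff (J₁.prod J₂) ((J₁.prod J₂).prod 𝓘(ℝ, (F₁ × F₂) →L[ℝ] (F₁ × F₂) →L[ℝ] ℝ)) ∞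
      (fun p : N₁ × N₂ ↦ TotalSpace.mk' ((F₁ × F₂) →L[ℝ] (F₁ × F₂) →L[ℝ] ℝ)
        (E := fun p : N₁ × N₂ ↦
          TangentSpace (J₁.prod J₂) p →L[ℝ] TangentSpace (J₁.prod J₂) p →L[ℝ] ℝ)
        p (prodInner h₁ h₂ p)) := by
  intro p₀
  rw [contMDiffAt_section]
  have c1 := (contMDiffAt_section p₀.1).1 (h₁.contMDiff p₀.1)
  have c2 := (contMDiffAt_section p₀.2).1 (h₂.contMDiff p₀.2)
  have k1 : ContMDiffAt (J₁.prod J₂) 𝓘(ℝ, (F₁ × F₂) →L[ℝ] (F₁ × F₂) →L[ℝ] ℝ) ∞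
      (fun p : N₁ × N₂ ↦ pullbackForm
        (trivializationAt (F₁ →L[ℝ] F₁ →L[ℝ] ℝ)
          (fun y : N₁ ↦ TangentSpace J₁ y →L[ℝ] TangentSpace J₁ y →L[ℝ] ℝ) p₀.1
            ⟨p.1, h₁.inner p.1⟩).2 (ContinuousLinearMap.fst ℝ F₁ F₂)) p₀ := by
    have hc := ContMDiffAt.comp p₀ (g := fun x : N₁ ↦ (trivializationAt (F₁ →L[ℝ] F₁ →L[ℝ] ℝ)
          (fun y : N₁ ↦ TangentSpace J₁ y →L[ℝ] TangentSpace J₁ y →L[ℝ] ℝ) p₀.1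
            ⟨x, h₁.inner x⟩).2) c1 (contMDiffAt_fst (I := J₁) (J := J₂) (p := p₀))
    exact ((contMDiff_pullbackForm (ContinuousLinearMap.fst ℝ F₁ F₂)).contMDiffAt).comp p₀ hc
  have k2 : ContMDiffAt (J₁.prod J₂) 𝓘(ℝ, (F₁ × F₂) →L[ℝ] (F₁ × F₂) →L[ℝ] ℝ) ∞
      (fun p : N₁ × N₂ ↦ pullbackForm
        (trivializationAt (F₂ →L[ℝ] F₂ →L[ℝ] ℝ)
          (fun y : N₂ ↦ TangentSpace J₂ y →L[ℝ] TangentSpace J₂ y →L[ℝ] ℝ) p₀.2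
            ⟨p.2, h₂.inner p.2⟩).2 (ContinuousLinearMap.snd ℝ F₁ F₂)) p₀ := by
    have hc := ContMDiffAt.comp p₀ (g := fun x : N₂ ↦ (trivializationAt (F₂ →L[ℝ] F₂ →L[ℝ] ℝ)
          (fun y : N₂ ↦ TangentSpace J₂ y →L[ℝ] TangentSpace J₂ y →L[ℝ] ℝ) p₀.2
            ⟨x, h₂.inner x⟩).2) c2 (contMDiffAt_snd (I := J₁) (J := J₂) (p := p₀))
    exact ((contMDiff_pullbackForm (ContinuousLinearMap.snd ℝ F₁ F₂)).contMDiffAt).comp p₀ hc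
  refine (k1.add k2).congr_of_eventuallyEq ?_
  filter_upwards [(chartAt (ModelProd H₁ H₂) p₀).open_source.mem_nhds
    (mem_chart_source (ModelProd H₁ H₂) p₀)] with p hp
  have hp1 : p.1 ∈ (chartAt H₁ p₀.1).source := by
    rw [prodChartedSpace_chartAt] at hp
    exact hp.1
  have hp2 : p.2 ∈ (chartAt H₂ p₀.2).source := by
    rw [prodChartedSpace_chartAt] at hp
    exact hp.2
  refine ContinuousLinearMap.ext fun u ↦ ContinuousLinearMap.ext fun v ↦ ?_
  have hD (w : F₁ × F₂) :
      mfderivWithin 𝓘(ℝ, F₁ × F₂) (J₁.prod J₂) (extChartAt (J₁.prod J₂) p₀).symm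
        (Set.range (J₁.prod J₂)) (extChartAt (J₁.prod J₂) p₀ p) w =
      ((mfderivWithin 𝓘(ℝ, F₁) J₁ (extChartAt J₁ p₀.1).symm (Set.range J₁)
          (extChartAt J₁ p₀.1 p.1) w.1,
        mfderivWithin 𝓘(ℝ, F₂) J₂ (extChartAt J₂ p₀.2).symm (Set.range J₂)
          (extChartAt J₂ p₀.2 p.2) w.2) : F₁ × F₂) := by
    have m1 := mdifferentiableWithinAt_extChartAt_symm (I := J₁) (x := p₀.1)
      (z := extChartAt J₁ p₀.1 p.1) ((extChartAt J₁ p₀.1).map_source (by simpa using hp1))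
    have m2 := mdifferentiableWithinAt_extChartAt_symm (I := J₂) (x := p₀.2)
      (z := extChartAt J₂ p₀.2 p.2) ((extChartAt J₂ p₀.2).map_source (by simpa using hp2))
    have u1 : UniqueMDiffWithinAt 𝓘(ℝ, F₁) (Set.range J₁) (extChartAt J₁ p₀.1 p.1) :=
      (J₁.uniqueDiffOn _ (by simp [extChartAt])).uniqueMDiffWithinAt
    have u2 : UniqueMDiffWithinAt 𝓘(ℝ, F₂) (Set.range J₂) (extChartAt J₂ p₀.2 p.2) :=
      (J₂.uniqueDiffOn _ (by simp [extChartAt])).uniqueMDiffWithinAt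
    have key := mfderivWithin_prodMap
      (p := (extChartAt J₁ p₀.1 p.1, extChartAt J₂ p₀.2 p.2)) m1 m2 u1 u2
    have hr : Set.range (J₁.prod J₂) = Set.range J₁ ×ˢ Set.range J₂ := by
      rw [← Set.range_prodMap]; rfl
    have he : ((extChartAt (J₁.prod J₂) p₀).symm : F₁ × F₂ → N₁ × N₂) =
        Prod.map (extChartAt J₁ p₀.1).symm (extChartAt J₂ p₀.2).symm := by
      rw [extChartAt_prod]; rfl
    have hx : extChartAt (J₁.prod J₂) p₀ p =
        (extChartAt J₁ p₀.1 p.1, extChartAt J₂ p₀.2 p.2) := by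
      rw [extChartAt_prod]; rfl
    rw [hr, he, hx]
    rw [← modelWithCornersSelf_prod, chartedSpaceSelf_prod] at key
    exact DFunLike.congr_fun key w
  rw [trivializationAt_form_apply p₀ p hp, hD, hD]
  refine (prodInner_apply h₁ h₂ p _ _).trans ?_
  change _ = pullbackForm _ _ u v + pullbackForm _ _ u v
  rw [pullbackForm_apply, pullbackForm_apply,
    trivializationAt_form_apply p₀.1 p.1 hp1, trivializationAt_form_apply p₀.2 p.2 hp2]
  rfl

/-- The Riemannian product metric `h₁ × h₂` on `N₁ × N₂`. -/
def prodMetric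
    (h₁ : ContMDiffRiemannianMetric J₁ ∞ F₁ (TangentSpace J₁ : N₁ → Type _))
    (h₂ : ContMDiffRiemannianMetric J₂ ∞ F₂ (TangentSpace J₂ : N₂ → Type _)) :
    ContMDiffRiemannianMetric (J₁.prod J₂) ∞ (F₁ × F₂)
      (TangentSpace (J₁.prod J₂) : N₁ × N₂ → Type _) where
  inner p := prodInner h₁ h₂ p
  symm p v w := by
    have a := prodInner_apply h₁ h₂ p v w
    have b := prodInner_apply h₁ h₂ p w v
    have c := h₁.symm p.1 (Prod.fst v) (Prod.fst w)
    have d := h₂.symm p.2 (Prod.snd v) (Prod.snd w)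
    exact a.trans ((congrArg₂ (· + ·) c d).trans b.symm)
  pos p v hv := by
    have a := prodInner_apply h₁ h₂ p v v
    have n1 : 0 ≤ h₁.inner p.1 (Prod.fst v) (Prod.fst v) := inner_self_nonneg h₁ p.1 _
    have n2 : 0 ≤ h₂.inner p.2 (Prod.snd v) (Prod.snd v) := by
      by_cases h : (Prod.snd v : TangentSpace J₂ p.2) = 0
      · rw [h]; simp
      · exact (h₂.pos p.2 _ h).le
    refine lt_of_lt_of_eq ?_ a.symm
    by_cases h : (Prod.fst v : TangentSpace J₁ p.1) = 0
    · have h' : (Prod.snd v : TangentSpace J₂ p.2) ≠ 0 := fun h' ↦ hv (Prod.ext h h')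
      exact add_pos_of_nonneg_of_pos n1 (h₂.pos p.2 _ h')
    · exact add_pos_of_pos_of_nonneg (h₁.pos p.1 _ h) n2
  isVonNBounded p := by
    have b1 : Bornology.IsVonNBounded ℝ {v : F₁ | h₁.inner p.1 v v < 1} := h₁.isVonNBounded p.1
    have b2 : Bornology.IsVonNBounded ℝ {v : F₂ | h₂.inner p.2 v v < 1} := h₂.isVonNBounded p.2
    rw [NormedSpace.isVonNBounded_iff] at b1 b2
    have b3 := (NormedSpace.isVonNBounded_iff ℝ (E := F₁ × F₂)).2 (b1.prod b2)
    refine Bornology.IsVonNBounded.subset ?_ b3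
    intro v hv
    have a := prodInner_apply h₁ h₂ p v v
    have hv' : h₁.inner p.1 (Prod.fst v) (Prod.fst v) +
        h₂.inner p.2 (Prod.snd v) (Prod.snd v) < 1 := lt_of_eq_of_lt a.symm hv
    have n1 : 0 ≤ h₁.inner p.1 (Prod.fst v) (Prod.fst v) := inner_self_nonneg h₁ p.1 _
    have n2 : 0 ≤ h₂.inner p.2 (Prod.snd v) (Prod.snd v) := inner_self_nonneg h₂ p.2 _
    exact ⟨by change h₁.inner p.1 (Prod.fst v) (Prod.fst v) < 1; linarith,
      by change h₂.inner p.2 (Prod.snd v) (Prod.snd v) < 1; linarith⟩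
  contMDiff := contMDiff_prodInner h₁ h₂

end ProductMetric

/-! ## Riemannian calculus in coordinates

Below `G` is a Riemannian metric on (an open subset of) `E`, `K` is a Riemannian metric on (an open
subset of) `F`, and `f` is a map from the first to the second. A vector `u` also stands for the
constant (coordinate) vector field with value `u`, so that Lie brackets of such fields vanish. -/

section Local

variable {E : Type*} [NormedAddCommGroup E] [NormedSpace ℝ E]
  {F : Type*} [NormedAddCommGroup F] [NormedSpace ℝ F]

/-- The Levi-Civita connection in coordinates: `christoffel G x u v` is the value at `x` of `∇_u v`
for the constant fields `u`, `v`. It is the vector `w` with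
`2 G(w, z) = (D_u G)(v, z) + (D_v G)(u, z) - (D_z G)(u, v)` for all `z`, that is,
`w^k = Γ^k_{ij} u^i v^j`. -/
def christoffel (G : E → E →L[ℝ] E →L[ℝ] ℝ) (x u v : E) : E :=
  (G x).inverse ((1 / 2 : ℝ) •
    (fderiv ℝ G x u v + fderiv ℝ G x v u - ((fderiv ℝ G x).flip u).flip v))

/-- The Riemann curvature `R(X, Y)Z = ∇_X ∇_Y Z - ∇_Y ∇_X Z - ∇_{[X, Y]} Z` at `x`, computed with
constant fields. -/
def curvature (G : E → E →L[ℝ] E →L[ℝ] ℝ) (x X Y Z : E) : E :=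
  (fderiv ℝ (fun y ↦ christoffel G y Y Z) x X + christoffel G x X (christoffel G x Y Z)) -
    (fderiv ℝ (fun y ↦ christoffel G y X Z) x Y + christoffel G x Y (christoffel G x X Z))

/-- The trace `∑_{i,j} g^{ij} T(b_i, b_j) = ∑_i T(b_i, (b^i)^♯)` of a bilinear map `T` with respect
to an inner product `g`, where `(b_i)` is a basis, `(b^i)` its dual basis, and `♯` is the inverse of
`v ↦ g(v, ·)`. It equals `∑_i T(e_i, e_i)` for every `g`-orthonormal basis `(e_i)`. -/
def metricTrace [FiniteDimensional ℝ E] (g : E →L[ℝ] E →L[ℝ] ℝ) (T : E → E → F) : F :=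
  ∑ i, T (Module.finBasis ℝ E i)
    (g.inverse (LinearMap.toContinuousLinearMap ((Module.finBasis ℝ E).coord i)))

/-- The pullback connection: `∇^f_u V` at `x`, for a vector field `V` along `f`. -/
def covDerivAlong (K : F → F →L[ℝ] F →L[ℝ] ℝ) (f : E → F) (V : E → F) (x u : E) : F :=
  fderiv ℝ V x u + christoffel K (f x) (fderiv ℝ f x u) (V x)

/-- The tension field `τ(f) = Trace_G ∇df`, where `∇df(u, v) = ∇^f_u (df v) - df (∇_u v)`. -/
def localTension [FiniteDimensional ℝ E]
    (G : E → E →L[ℝ] E →L[ℝ] ℝ) (K : F → F →L[ℝ] F →L[ℝ] ℝ) (f : E → F) (x : E) : F :=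
  metricTrace (G x) fun u v ↦
    covDerivAlong K f (fun y ↦ fderiv ℝ f y v) x u - fderiv ℝ f x (christoffel G x u v)

/-- The bitension field
`τ²(f) = Trace_G (∇^f ∇^f - ∇^f_∇) τ(f) - Trace_G R(df, τ(f)) df`. -/
def localBitension [FiniteDimensional ℝ E]
    (G : E → E →L[ℝ] E →L[ℝ] ℝ) (K : F → F →L[ℝ] F →L[ℝ] ℝ) (f : E → F) (x : E) : F :=
  metricTrace (G x) (fun u v ↦
    covDerivAlong K f (fun y ↦ covDerivAlong K f (localTension G K f) y v) x u -
      covDerivAlong K f (localTension G K f) x (christoffel G x u v)) -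
  metricTrace (G x) (fun u v ↦
    curvature K (f x) (fderiv ℝ f x u) (localTension G K f x) (fderiv ℝ f x v))

end Local

/-! ## Harmonic and biharmonic maps between Riemannian manifolds -/

section Manifold

variable
  {E : Type*} [NormedAddCommGroup E] [NormedSpace ℝ E]
  {H : Type*} [TopologicalSpace H] {I : ModelWithCorners ℝ E H}
  {M : Type*} [TopologicalSpace M] [ChartedSpace H M] [IsManifold I ∞ M]
  {F : Type*} [NormedAddCommGroup F] [NormedSpace ℝ F]
  {H' : Type*} [TopologicalSpace H'] {J : ModelWithCorners ℝ F H'}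
  {N : Type*} [TopologicalSpace N] [ChartedSpace H' N] [IsManifold J ∞ N]

/-- The metric `g` in the chart around `x₀`: the pullback of `g` by the inverse of the chart. -/
def chartMetric (g : ContMDiffRiemannianMetric I ∞ E (TangentSpace I : M → Type _)) (x₀ : M) :
    E → E →L[ℝ] E →L[ℝ] ℝ := fun y ↦
  pullbackForm (W := E) (g.inner ((extChartAt I x₀).symm y))
    (mfderivWithin 𝓘(ℝ, E) I (extChartAt I x₀).symm (Set.range I) y)

/-- The tension field of `φ` in the charts around `x₀` and `φ x₀`. -/
def tensionInChart [FiniteDimensional ℝ E]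
    (g : ContMDiffRiemannianMetric I ∞ E (TangentSpace I : M → Type _))
    (h : ContMDiffRiemannianMetric J ∞ F (TangentSpace J : N → Type _)) (φ : M → N) (x₀ : M) :
    E → F :=
  localTension (chartMetric g x₀) (chartMetric h (φ x₀)) (writtenInExtChartAt I J x₀ φ)

/-- The bitension field of `φ` in the charts around `x₀` and `φ x₀`. -/
def bitensionInChart [FiniteDimensional ℝ E]
    (g : ContMDiffRiemannianMetric I ∞ E (TangentSpace I : M → Type _))
    (h : ContMDiffRiemannianMetric J ∞ F (TangentSpace J : N → Type _)) (φ : M → N) (x₀ : M) :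
    E → F :=
  localBitension (chartMetric g x₀) (chartMetric h (φ x₀)) (writtenInExtChartAt I J x₀ φ)

/-- `φ` is harmonic: its tension field vanishes identically, i.e. in charts near every point. -/
def IsHarmonic [FiniteDimensional ℝ E]
    (g : ContMDiffRiemannianMetric I ∞ E (TangentSpace I : M → Type _))
    (h : ContMDiffRiemannianMetric J ∞ F (TangentSpace J : N → Type _)) (φ : M → N) : Prop :=
  ∀ x₀ : M, ∀ᶠ y in 𝓝 (extChartAt I x₀ x₀), tensionInChart g h φ x₀ y = 0

/-- `φ` is biharmonic: its bitension field vanishes identically, i.e. in charts near every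
point. -/
def IsBiharmonic [FiniteDimensional ℝ E]
    (g : ContMDiffRiemannianMetric I ∞ E (TangentSpace I : M → Type _))
    (h : ContMDiffRiemannianMetric J ∞ F (TangentSpace J : N → Type _)) (φ : M → N) : Prop :=
  ∀ x₀ : M, ∀ᶠ y in 𝓝 (extChartAt I x₀ x₀), bitensionInChart g h φ x₀ y = 0

/-- A proper biharmonic map is a biharmonic map that is not harmonic. -/
def IsProperBiharmonic [FiniteDimensional ℝ E]
    (g : ContMDiffRiemannianMetric I ∞ E (TangentSpace I : M → Type _))
    (h : ContMDiffRiemannianMetric J ∞ F (TangentSpace J : N → Type _)) (φ : M → N) : Prop :=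
  IsBiharmonic g h φ ∧ ¬ IsHarmonic g h φ

end Manifold

end BiharmonicMaps

end

/-!
The two projections of `N₁ × N₂` are linear in product charts, and they map the Christoffel symbols
of `h₁ × h₂` to those of `h₁` and of `h₂`. The tension and bitension fields are natural under
post-composition with a linear map that intertwines the connections, so `τ(φ, ψ) = (τ(φ), τ(ψ))` and
`τ²(φ, ψ) = (τ²(φ), τ²(ψ))`. As `τ²(f)` is linear in `τ(f)`, harmonic maps are biharmonic.
-/

namespace BiharmonicMaps

section BilinearForms

variable {V V₁ V₂ W : Type*} [NormedAddCommGroup V] [NormedSpace ℝ V]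
  [NormedAddCommGroup V₁] [NormedSpace ℝ V₁] [NormedAddCommGroup V₂] [NormedSpace ℝ V₂]
  [NormedAddCommGroup W] [NormedSpace ℝ W]

-- The norm of `V` is only equivalent to the one `B` induces, so the Riesz representation theorem is
-- applied to a copy of `V` carrying the inner product `B`.
theorem exists_equiv_innerProductSpace.{u} {V : Type u} [NormedAddCommGroup V] [NormedSpace ℝ V]
    {B : V →L[ℝ] V →L[ℝ] ℝ} (symm : ∀ v w, B v w = B w v) (pos : ∀ v, v ≠ 0 → 0 < B v v)
    (bdd : Bornology.IsVonNBounded ℝ {v | B v v < 1}) :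
    ∃ (W : Type u) (_ : NormedAddCommGroup W) (_ : InnerProductSpace ℝ W) (e : V ≃L[ℝ] W),
      ∀ v w, inner ℝ (e v) (e w) = B v w := by
  let core : InnerProductSpace.Core ℝ V :=
    { inner := fun v w ↦ B v w
      conj_inner_symm := fun v w ↦ symm w v
      re_inner_nonneg := fun v ↦ by
        obtain rfl | hv := eq_or_ne v 0
        · simp
        · exact (pos v hv).le
      add_left := fun u v w ↦ by simp
      smul_left := fun u v r ↦ by simp
      definite := fun v hv ↦ by_contra fun h ↦ (pos v h).ne' hv }
  have hcont : ContinuousAt (fun v : V ↦ core.inner v v) 0 :=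
    (by fun_prop : Continuous fun v ↦ B v v).continuousAt
  exact ⟨V, core.toNormedAddCommGroupOfTopology hcont bdd, .ofCoreOfTopology core hcont bdd,
    { LinearEquiv.refl ℝ V with
      continuous_toFun := continuous_id
      continuous_invFun := continuous_id }, fun _ _ ↦ rfl⟩

theorem isInvertible_of_posDef [CompleteSpace V] {B : V →L[ℝ] V →L[ℝ] ℝ}
    (symm : ∀ v w, B v w = B w v) (pos : ∀ v, v ≠ 0 → 0 < B v v)
    (bdd : Bornology.IsVonNBounded ℝ {v | B v v < 1}) : B.IsInvertible := by
  obtain ⟨W, _, _, e, he⟩ := exists_equiv_innerProductSpace symm pos bdd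
  have : CompleteSpace W :=
    (completeSpace_congr (e := e.toEquiv) e.isUniformEmbedding).1 inferInstance
  let riesz := (InnerProductSpace.toDual ℝ W).toContinuousLinearEquiv
  refine ⟨(e.trans riesz).trans (e.symm.arrowCongr (.refl ℝ ℝ)), ?_⟩
  ext v w
  exact he v w

theorem isInvertible_pullbackForm {B : V →L[ℝ] V →L[ℝ] ℝ} {A : W →L[ℝ] V}
    (hB : B.IsInvertible) (hA : A.IsInvertible) : (pullbackForm B A).IsInvertible := by
  obtain ⟨b, rfl⟩ := hB
  obtain ⟨a, rfl⟩ := hA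
  exact ⟨(a.trans b).trans (a.symm.arrowCongr (.refl ℝ ℝ)), rfl⟩

/-- The orthogonal direct sum of two bilinear forms, on the product of the underlying spaces. -/
noncomputable def prodForm (B₁ : V₁ →L[ℝ] V₁ →L[ℝ] ℝ) (B₂ : V₂ →L[ℝ] V₂ →L[ℝ] ℝ) :
    (V₁ × V₂) →L[ℝ] (V₁ × V₂) →L[ℝ] ℝ :=
  pullbackForm B₁ (.fst ℝ V₁ V₂) + pullbackForm B₂ (.snd ℝ V₁ V₂)

theorem prodForm_apply (B₁ : V₁ →L[ℝ] V₁ →L[ℝ] ℝ) (B₂ : V₂ →L[ℝ] V₂ →L[ℝ] ℝ) (v w : V₁ × V₂) :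
    prodForm B₁ B₂ v w = B₁ v.1 w.1 + B₂ v.2 w.2 :=
  rfl

theorem isInvertible_prodForm {B₁ : V₁ →L[ℝ] V₁ →L[ℝ] ℝ} {B₂ : V₂ →L[ℝ] V₂ →L[ℝ] ℝ}
    (h₁ : B₁.IsInvertible) (h₂ : B₂.IsInvertible) : (prodForm B₁ B₂).IsInvertible := by
  obtain ⟨e₁, rfl⟩ := h₁
  obtain ⟨e₂, rfl⟩ := h₂
  exact ⟨(e₁.prodCongr e₂).trans (ContinuousLinearMap.coprodEquivL ℝ), rfl⟩

end BilinearForms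

/-! ## Regularity of the tension field -/

section LocalCalculus

set_option maxSynthPendingDepth 3

variable {E : Type*} [NormedAddCommGroup E] [NormedSpace ℝ E]
  {F : Type*} [NormedAddCommGroup F] [NormedSpace ℝ F]
  {F' : Type*} [NormedAddCommGroup F'] [NormedSpace ℝ F']
  {G : E → E →L[ℝ] E →L[ℝ] ℝ} {K : F → F →L[ℝ] F →L[ℝ] ℝ} {K' : F' → F' →L[ℝ] F' →L[ℝ] ℝ}
  {P : F →L[ℝ] F'} {f V W : E → F} {x : E} {n : WithTop ℕ∞}

/-- The field `K` of bilinear forms is a `C^n` pseudo-Riemannian metric near `z`, except that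
symmetry is not imposed: it is `C^n` and nondegenerate at `z`. -/
structure IsNondegMetricAt (n : WithTop ℕ∞) (K : F → F →L[ℝ] F →L[ℝ] ℝ) (z : F) : Prop where
  contDiffAt : ContDiffAt ℝ n K z
  isInvertible : (K z).IsInvertible

theorem IsNondegMetricAt.of_le {m : WithTop ℕ∞} {z : F} (h : IsNondegMetricAt n K z)
    (hmn : m ≤ n) : IsNondegMetricAt m K z :=
  ⟨h.contDiffAt.of_le hmn, h.isInvertible⟩

theorem IsNondegMetricAt.contDiffAt_inverse [CompleteSpace F] {a : E → F}
    (hK : IsNondegMetricAt n K (a x)) (ha : ContDiffAt ℝ n a x) :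
    ContDiffAt ℝ n (fun y ↦ (K (a y)).inverse) x :=
  ContDiffAt.comp (g := ContinuousLinearMap.inverse) x
    hK.isInvertible.contDiffAt_map_inverse (hK.contDiffAt.comp x ha)

theorem contDiffAt_christoffel [CompleteSpace F] {a b c : E → F}
    (hK : IsNondegMetricAt (n + 1) K (a x)) (ha : ContDiffAt ℝ n a x)
    (hb : ContDiffAt ℝ n b x) (hc : ContDiffAt ℝ n c x) :
    ContDiffAt ℝ n (fun y ↦ christoffel K (a y) (b y) (c y)) x := by
  have hinv : ContDiffAt ℝ n (fun y ↦ (K (a y)).inverse) x :=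
    (hK.of_le le_self_add).contDiffAt_inverse ha
  have hdK : ContDiffAt ℝ n (fun y ↦ fderiv ℝ K (a y)) x :=
    (hK.contDiffAt.fderiv_right le_rfl).comp x ha
  have hflip : ContDiffAt ℝ n (fun y ↦ ((fderiv ℝ K (a y)).flip (b y)).flip (c y)) x := by
    have hb' := ((ContinuousLinearMap.flipₗᵢ ℝ F F (F →L[ℝ] ℝ)).contDiff.contDiffAt.comp x
      hdK).clm_apply hb
    exact ((ContinuousLinearMap.flipₗᵢ ℝ F F ℝ).contDiff.contDiffAt.comp x hb').clm_apply hc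
  unfold christoffel
  fun_prop

theorem IsNondegMetricAt.differentiableAt_christoffel [CompleteSpace F] {z : F}
    (hK : IsNondegMetricAt 2 K z) (u v : F) :
    DifferentiableAt ℝ (fun y ↦ christoffel K y u v) z :=
  (contDiffAt_christoffel (n := 1) (hK.of_le one_add_one_eq_two.le) contDiffAt_fun_id
    contDiffAt_const contDiffAt_const).differentiableAt (by simp)

theorem contDiffAt_covDerivAlong [CompleteSpace F] {u : E → E}
    (hK : IsNondegMetricAt (n + 1) K (f x)) (hf : ContDiffAt ℝ (n + 1) f x)
    (hV : ContDiffAt ℝ (n + 1) V x) (hu : ContDiffAt ℝ n u x) :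
    ContDiffAt ℝ n (fun y ↦ covDerivAlong K f V y (u y)) x :=
  ((hV.fderiv_right le_rfl).clm_apply hu).add
    (contDiffAt_christoffel hK (hf.of_le le_self_add)
      ((hf.fderiv_right le_rfl).clm_apply hu) (hV.of_le le_self_add))

theorem covDerivAlong_fderiv_apply (hf : ContDiffAt ℝ 2 f x) (u v : E) :
    covDerivAlong K f (fun y ↦ fderiv ℝ f y v) x u =
      fderiv ℝ (fderiv ℝ f) x u v + christoffel K (f x) (fderiv ℝ f x u) (fderiv ℝ f x v) := by
  have hdf : DifferentiableAt ℝ (fderiv ℝ f) x :=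
    (hf.fderiv_right (m := 1) one_add_one_eq_two.le).differentiableAt (by simp)
  simp [covDerivAlong, fderiv_clm_apply hdf (differentiableAt_const v)]

theorem contDiffAt_localTension [FiniteDimensional ℝ E] [CompleteSpace F]
    (hG : IsNondegMetricAt (n + 1) G x) (hK : IsNondegMetricAt (n + 1) K (f x))
    (hf : ContDiffAt ℝ (n + 2) f x) :
    ContDiffAt ℝ n (localTension G K f) x := by
  have : CompleteSpace E := FiniteDimensional.complete ℝ E
  have hfn : ContDiffAt ℝ n f x := hf.of_le le_self_add
  have hdf : ContDiffAt ℝ (n + 1) (fderiv ℝ f) x :=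
    hf.fderiv_right (by rw [add_assoc, one_add_one_eq_two])
  have hdf' : ContDiffAt ℝ n (fderiv ℝ f) x := hdf.of_le le_self_add
  have : ContDiffAt ℝ n (fderiv ℝ (fderiv ℝ f)) x := hdf.fderiv_right le_rfl
  have hhess : ∀ u : E, ∀ {v : E → E}, ContDiffAt ℝ n v x → ContDiffAt ℝ n (fun y ↦
      fderiv ℝ (fderiv ℝ f) y u (v y) +
        christoffel K (f y) (fderiv ℝ f y u) (fderiv ℝ f y (v y)) -
        fderiv ℝ f y (christoffel G y u (v y))) x := by
    intro u v hv
    have hΓK : ContDiffAt ℝ n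
        (fun y ↦ christoffel K (f y) (fderiv ℝ f y u) (fderiv ℝ f y (v y))) x :=
      contDiffAt_christoffel hK hfn (by fun_prop) (by fun_prop)
    have hΓG : ContDiffAt ℝ n (fun y ↦ christoffel G y u (v y)) x :=
      contDiffAt_christoffel hG contDiffAt_fun_id contDiffAt_const hv
    fun_prop
  have hinv : ContDiffAt ℝ n (fun y ↦ (G y).inverse) x :=
    (hG.of_le le_self_add).contDiffAt_inverse contDiffAt_fun_id
  unfold localTension metricTrace
  refine ContDiffAt.sum fun i _ ↦
    (hhess (Module.finBasis ℝ E i) (hinv.clm_apply (contDiffAt_const (c :=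
      LinearMap.toContinuousLinearMap ((Module.finBasis ℝ E).coord i))))).congr_of_eventuallyEq ?_
  filter_upwards [(hf.of_le le_add_self).eventually (by simp)] with y hy
  rw [covDerivAlong_fderiv_apply hy]

/-! ## Naturality under affine linear maps -/

/-- The linear map `P`, viewed as a map from the metric `K` to the metric `K'`, is affine at `z`:
it intertwines the Levi-Civita connections there. -/
def IsAffineAt (P : F →L[ℝ] F') (K : F → F →L[ℝ] F →L[ℝ] ℝ) (K' : F' → F' →L[ℝ] F' →L[ℝ] ℝ)
    (z : F) : Prop :=
  ∀ u v, P (christoffel K z u v) = christoffel K' (P z) (P u) (P v)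

theorem fderiv_clm_comp_left (P : F →L[ℝ] F') (hV : DifferentiableAt ℝ V x) :
    fderiv ℝ (fun y ↦ P (V y)) x = P.comp (fderiv ℝ V x) :=
  (P.hasFDerivAt.comp x hV.hasFDerivAt).fderiv

theorem map_metricTrace [FiniteDimensional ℝ E] (P : F →L[ℝ] F') (g : E →L[ℝ] E →L[ℝ] ℝ)
    (T : E → E → F) : P (metricTrace g T) = metricTrace g fun u v ↦ P (T u v) :=
  map_sum _ _ _

theorem covDerivAlong_congr (h : V =ᶠ[𝓝 x] W) (u : E) :
    covDerivAlong K f V x u = covDerivAlong K f W x u := by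
  rw [covDerivAlong, covDerivAlong, h.fderiv_eq, h.eq_of_nhds]

theorem map_covDerivAlong (hP : IsAffineAt P K K' (f x)) (hf : DifferentiableAt ℝ f x)
    (hV : DifferentiableAt ℝ V x) (u : E) :
    covDerivAlong K' (fun y ↦ P (f y)) (fun y ↦ P (V y)) x u = P (covDerivAlong K f V x u) := by
  simp [covDerivAlong, fderiv_clm_comp_left P hf, fderiv_clm_comp_left P hV, hP _ _]

theorem map_localTension [FiniteDimensional ℝ E] (hP : IsAffineAt P K K' (f x))
    (hf : ContDiffAt ℝ 2 f x) :
    localTension G K' (fun y ↦ P (f y)) x = P (localTension G K f x) := by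
  have hd : ∀ᶠ y in 𝓝 x, fderiv ℝ (fun y ↦ P (f y)) y = P.comp (fderiv ℝ f y) := by
    filter_upwards [hf.eventually (by simp)] with y hy
    exact fderiv_clm_comp_left P (hy.differentiableAt (by simp))
  have hdd : fderiv ℝ (fderiv ℝ fun y ↦ P (f y)) x =
      (ContinuousLinearMap.compL ℝ E F F' P).comp (fderiv ℝ (fderiv ℝ f) x) := by
    rw [Filter.EventuallyEq.fderiv_eq hd]
    exact fderiv_clm_comp_left (ContinuousLinearMap.compL ℝ E F F' P)
      ((hf.fderiv_right (m := 1) one_add_one_eq_two.le).differentiableAt (by simp))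
  have hPf : ContDiffAt ℝ 2 (fun y ↦ P (f y)) x := P.contDiff.contDiffAt.comp x hf
  simp only [localTension, map_metricTrace, covDerivAlong_fderiv_apply hf,
    covDerivAlong_fderiv_apply hPf, hdd, hd.self_of_nhds, map_sub, map_add, hP _ _,
    ContinuousLinearMap.comp_apply, ContinuousLinearMap.compL_apply]

theorem map_curvature [CompleteSpace F] [CompleteSpace F'] {z : F}
    (hP : ∀ᶠ z in 𝓝 z, IsAffineAt P K K' z) (hK : IsNondegMetricAt 2 K z)
    (hK' : IsNondegMetricAt 2 K' (P z)) (X Y Z : F) :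
    curvature K' (P z) (P X) (P Y) (P Z) = P (curvature K z X Y Z) := by
  have hΓ (u v w : F) : fderiv ℝ (fun y ↦ christoffel K' y (P v) (P w)) (P z) (P u) =
      P (fderiv ℝ (fun y ↦ christoffel K y v w) z u) := by
    have heq : (fun y ↦ P (christoffel K y v w)) =ᶠ[𝓝 z]
        fun y ↦ christoffel K' (P y) (P v) (P w) := hP.mono fun y hy ↦ hy v w
    have hchain := ((hK'.differentiableAt_christoffel (P v) (P w)).hasFDerivAt.comp z
      P.hasFDerivAt).fderiv
    rw [← ContinuousLinearMap.comp_apply P,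
      ← fderiv_clm_comp_left P (hK.differentiableAt_christoffel v w), heq.fderiv_eq]
    exact (DFunLike.congr_fun hchain u).symm
  simp only [curvature, map_sub, map_add, hΓ, hP.self_of_nhds _ _]

theorem map_covDerivAlong_localTension [FiniteDimensional ℝ E]
    (hP : ∀ᶠ z in 𝓝 (f x), IsAffineAt P K K' z) (hf : ContDiffAt ℝ 2 f x)
    (hτ : DifferentiableAt ℝ (localTension G K f) x) (u : E) :
    covDerivAlong K' (fun y ↦ P (f y)) (localTension G K' fun y ↦ P (f y)) x u =
      P (covDerivAlong K f (localTension G K f) x u) := by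
  have hτP : localTension G K' (fun y ↦ P (f y)) =ᶠ[𝓝 x] fun y ↦ P (localTension G K f y) := by
    filter_upwards [hf.eventually (by simp), hf.continuousAt.eventually hP] with y hy hPy
    exact map_localTension hPy hy
  rw [covDerivAlong_congr hτP,
    map_covDerivAlong hP.self_of_nhds (hf.differentiableAt (by simp)) hτ]

theorem map_localBitension [FiniteDimensional ℝ E] [CompleteSpace F] [CompleteSpace F']
    (hP : ∀ᶠ z in 𝓝 (f x), IsAffineAt P K K' z) (hG : IsNondegMetricAt 3 G x)
    (hK : IsNondegMetricAt 3 K (f x)) (hK' : IsNondegMetricAt 2 K' (P (f x)))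
    (hf : ContDiffAt ℝ 4 f x) :
    localBitension G K' (fun y ↦ P (f y)) x = P (localBitension G K f x) := by
  have hf₂ : ContDiffAt ℝ 2 f x := hf.of_le (by norm_num)
  have hfd : DifferentiableAt ℝ f x := hf₂.differentiableAt (by simp)
  have hτ : ContDiffAt ℝ 2 (localTension G K f) x :=
    contDiffAt_localTension (hG.of_le two_add_one_eq_three.le)
      (hK.of_le two_add_one_eq_three.le) (hf.of_le two_add_two_eq_four.le)
  have hdτ (v : E) : DifferentiableAt ℝ (fun y ↦ covDerivAlong K f (localTension G K f) y v) x :=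
    (contDiffAt_covDerivAlong (n := 1) (hK.of_le (by norm_num))
      (hf₂.of_le one_add_one_eq_two.le) (hτ.of_le one_add_one_eq_two.le)
      contDiffAt_const).differentiableAt (by simp)
  have hPdτ (v : E) : (fun y ↦ covDerivAlong K' (fun y ↦ P (f y))
      (localTension G K' (fun y ↦ P (f y))) y v) =ᶠ[𝓝 x]
      fun y ↦ P (covDerivAlong K f (localTension G K f) y v) := by
    filter_upwards [hτ.eventually (by simp), hf₂.eventually (by simp),
      hf.continuousAt.eventually hP.eventually_nhds] with y hτy hfy hPy
    exact map_covDerivAlong_localTension hPy hfy (hτy.differentiableAt (by simp)) v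
  simp only [localBitension, map_sub, map_metricTrace, covDerivAlong_congr (hPdτ _),
    map_covDerivAlong hP.self_of_nhds hfd (hdτ _), (hPdτ _).eq_of_nhds,
    fderiv_clm_comp_left P hfd, map_localTension hP.self_of_nhds hf₂,
    ContinuousLinearMap.comp_apply, map_curvature hP (hK.of_le (by norm_num)) hK']

/-! ## Harmonic maps are biharmonic -/

theorem christoffel_zero_left (K : F → F →L[ℝ] F →L[ℝ] ℝ) (z v : F) :
    christoffel K z 0 v = 0 := by
  simp [christoffel]

theorem christoffel_zero_right (K : F → F →L[ℝ] F →L[ℝ] ℝ) (z u : F) :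
    christoffel K z u 0 = 0 := by
  simp [christoffel]

theorem covDerivAlong_zero (K : F → F →L[ℝ] F →L[ℝ] ℝ) (f : E → F) (x u : E) :
    covDerivAlong K f 0 x u = 0 := by
  simp [covDerivAlong, christoffel_zero_right]

theorem localBitension_eq_zero [FiniteDimensional ℝ E] (h : localTension G K f =ᶠ[𝓝 x] 0) :
    localBitension G K f x = 0 := by
  have hdτ (v : E) : (fun y ↦ covDerivAlong K f (localTension G K f) y v) =ᶠ[𝓝 x] 0 := by
    filter_upwards [h.eventuallyEq_nhds] with y hy
    rw [covDerivAlong_congr hy, covDerivAlong_zero, Pi.zero_apply]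
  simp [localBitension, metricTrace, covDerivAlong_congr (hdτ _), covDerivAlong_zero,
    (hdτ _).eq_of_nhds, h.eq_of_nhds, curvature, christoffel_zero_left, christoffel_zero_right]

/-! ## The Levi-Civita connection of a product metric -/

theorem christoffel_eq_iff {z u v w : F} (hK : (K z).IsInvertible) :
    christoffel K z u v = w ↔ ∀ t, 2 * K z w t =
      fderiv ℝ K z u v t + fderiv ℝ K z v u t - fderiv ℝ K z t u v := by
  rw [christoffel, hK.inverse_apply_eq, ContinuousLinearMap.ext_iff]
  refine forall_congr' fun t ↦ ?_
  simp only [smul_apply, sub_apply, add_apply, ContinuousLinearMap.flip_apply, smul_eq_mul]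
  constructor <;> intro h <;> linarith

theorem christoffel_congr {L : F → F →L[ℝ] F →L[ℝ] ℝ} {z : F} (h : K =ᶠ[𝓝 z] L) (u v : F) :
    christoffel K z u v = christoffel L z u v := by
  simp only [christoffel, h.fderiv_eq, h.eq_of_nhds]

theorem fderiv_form_apply {z : F} (hK : DifferentiableAt ℝ K z) (t u v : F) :
    fderiv ℝ (fun y ↦ K y u v) z t = fderiv ℝ K z t u v := by
  rw [fderiv_clm_apply (hK.clm_apply (differentiableAt_const u)) (differentiableAt_const v),
    fderiv_clm_apply hK (differentiableAt_const u)]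
  simp

theorem fderiv_prodForm_apply {z : F × F'} (hK : DifferentiableAt ℝ K z.1)
    (hK' : DifferentiableAt ℝ K' z.2) (t u v : F × F') :
    fderiv ℝ (fun y : F × F' ↦ prodForm (K y.1) (K' y.2)) z t u v =
      fderiv ℝ K z.1 t.1 u.1 v.1 + fderiv ℝ K' z.2 t.2 u.2 v.2 := by
  have hform : DifferentiableAt ℝ (fun y : F × F' ↦ prodForm (K y.1) (K' y.2)) z := by
    unfold prodForm pullbackForm
    fun_prop
  have hKuv : DifferentiableAt ℝ (fun y ↦ K y u.1 v.1) z.1 := by fun_prop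
  have hKuv' : DifferentiableAt ℝ (fun y ↦ K' y u.2 v.2) z.2 := by fun_prop
  have hsum := (hKuv.hasFDerivAt.comp z hasFDerivAt_fst).add
    (hKuv'.hasFDerivAt.comp z hasFDerivAt_snd)
  rw [← fderiv_form_apply hform, ← fderiv_form_apply hK, ← fderiv_form_apply hK']
  exact DFunLike.congr_fun hsum.fderiv t

theorem christoffel_prodForm {z : F × F'} (hK : IsNondegMetricAt 1 K z.1)
    (hK' : IsNondegMetricAt 1 K' z.2) (u v : F × F') :
    christoffel (fun y : F × F' ↦ prodForm (K y.1) (K' y.2)) z u v =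
      (christoffel K z.1 u.1 v.1, christoffel K' z.2 u.2 v.2) := by
  have hD := fderiv_prodForm_apply (hK.contDiffAt.differentiableAt (by simp))
    (hK'.contDiffAt.differentiableAt (by simp))
  rw [christoffel_eq_iff (isInvertible_prodForm hK.isInvertible hK'.isInvertible)]
  intro t
  have h₁ := (christoffel_eq_iff hK.isInvertible).1 (rfl : _ = christoffel K z.1 u.1 v.1) t.1
  have h₂ := (christoffel_eq_iff hK'.isInvertible).1 (rfl : _ = christoffel K' z.2 u.2 v.2) t.2
  rw [prodForm_apply, mul_add, h₁, h₂, hD, hD, hD]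
  ring

end LocalCalculus

/-! ## Charts -/

section MapsInCharts

variable {E : Type*} [NormedAddCommGroup E] [NormedSpace ℝ E]
  {H : Type*} [TopologicalSpace H] {I : ModelWithCorners ℝ E H}
  {M : Type*} [TopologicalSpace M] [ChartedSpace H M]
  {F : Type*} [NormedAddCommGroup F] [NormedSpace ℝ F]
  {H' : Type*} [TopologicalSpace H'] {J : ModelWithCorners ℝ F H'}
  {N : Type*} [TopologicalSpace N] [ChartedSpace H' N]
  {F₂ : Type*} [NormedAddCommGroup F₂] [NormedSpace ℝ F₂]
  {H₂ : Type*} [TopologicalSpace H₂] {J₂ : ModelWithCorners ℝ F₂ H₂}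
  {N₂ : Type*} [TopologicalSpace N₂] [ChartedSpace H₂ N₂]

theorem writtenInExtChartAt_prodMk (φ : M → N) (ψ : M → N₂) (x₀ : M) :
    writtenInExtChartAt I (J.prod J₂) x₀ (fun x ↦ (φ x, ψ x)) =
      fun y ↦ (writtenInExtChartAt I J x₀ φ y, writtenInExtChartAt I J₂ x₀ ψ y) := by
  ext y <;> simp [writtenInExtChartAt]

theorem eventually_mem_extChartAt_source {φ : M → N} {x₀ : M} (hφ : ContinuousAt φ x₀) :
    ∀ᶠ y in 𝓝 (extChartAt I x₀ x₀),
      φ ((extChartAt I x₀).symm y) ∈ (extChartAt J (φ x₀)).source := by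
  have hcont : ContinuousAt (fun y ↦ φ ((extChartAt I x₀).symm y)) (extChartAt I x₀ x₀) :=
    ContinuousAt.comp (by simpa using hφ) (continuousAt_extChartAt_symm x₀)
  exact hcont.eventually ((isOpen_extChartAt_source (φ x₀)).mem_nhds (by simp))

theorem eventually_writtenInExtChartAt_mem_target {φ : M → N} {x₀ : M}
    (hφ : ContinuousAt φ x₀) : ∀ᶠ y in 𝓝 (extChartAt I x₀ x₀),
      writtenInExtChartAt I J x₀ φ y ∈ (extChartAt J (φ x₀)).target :=
  (eventually_mem_extChartAt_source hφ).mono fun _ hy ↦ (extChartAt J (φ x₀)).map_source hy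

theorem eventually_contDiffAt_writtenInExtChartAt [I.Boundaryless] {n : WithTop ℕ∞}
    [IsManifold I n M] [IsManifold J n N] {φ : M → N} (hφ : ContMDiff I J n φ) (x₀ : M) :
    ∀ᶠ y in 𝓝 (extChartAt I x₀ x₀), ContDiffAt ℝ n (writtenInExtChartAt I J x₀ φ) y := by
  have hdom := Filter.inter_mem (extChartAt_target_mem_nhds (I := I) x₀)
    (eventually_mem_extChartAt_source (I := I) (J := J) hφ.continuous.continuousAt)
  filter_upwards [eventually_mem_nhds_iff.2 hdom] with y hy
  exact ((contMDiff_iff.1 hφ).2 x₀ (φ x₀)).contDiffAt hy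

theorem mfderivWithin_extChartAt_symm_prod [IsManifold J 1 N] [IsManifold J₂ 1 N₂]
    (p₀ : N × N₂) {z : F × F₂} (hz : z ∈ (extChartAt (J.prod J₂) p₀).target) (w : F × F₂) :
    mfderivWithin 𝓘(ℝ, F × F₂) (J.prod J₂) (extChartAt (J.prod J₂) p₀).symm
        (Set.range (J.prod J₂)) z w =
      ((mfderivWithin 𝓘(ℝ, F) J (extChartAt J p₀.1).symm (Set.range J) z.1 w.1,
        mfderivWithin 𝓘(ℝ, F₂) J₂ (extChartAt J₂ p₀.2).symm (Set.range J₂) z.2 w.2) :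
          F × F₂) := by
  rw [extChartAt_prod] at hz
  have hrange : Set.range (J.prod J₂) = Set.range J ×ˢ Set.range J₂ :=
    modelWithCorners_prod_coe J J₂ ▸ Set.range_prodMap
  have hsymm : ((extChartAt (J.prod J₂) p₀).symm : F × F₂ → N × N₂) =
      Prod.map (extChartAt J p₀.1).symm (extChartAt J₂ p₀.2).symm := by
    rw [extChartAt_prod]
    rfl
  have hprod := mfderivWithin_prodMap (p := z)
    (mdifferentiableWithinAt_extChartAt_symm (I := J) hz.1)
    (mdifferentiableWithinAt_extChartAt_symm (I := J₂) hz.2)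
    (J.uniqueDiffOn _ (extChartAt_target_subset_range _ hz.1)).uniqueMDiffWithinAt
    (J₂.uniqueDiffOn _ (extChartAt_target_subset_range _ hz.2)).uniqueMDiffWithinAt
  rw [← modelWithCornersSelf_prod, chartedSpaceSelf_prod] at hprod
  rw [hrange, hsymm]
  exact DFunLike.congr_fun hprod w

end MapsInCharts

section MetricsInCharts

variable {E : Type*} [NormedAddCommGroup E] [NormedSpace ℝ E]
  {H : Type*} [TopologicalSpace H] {I : ModelWithCorners ℝ E H}
  {M : Type*} [TopologicalSpace M] [ChartedSpace H M] [IsManifold I ∞ M]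
  (g : ContMDiffRiemannianMetric I ∞ E (TangentSpace I : M → Type _)) (x₀ : M) {y : E}

theorem isInvertible_chartMetric [CompleteSpace E] (hy : y ∈ (extChartAt I x₀).target) :
    (chartMetric g x₀ y).IsInvertible :=
  isInvertible_pullbackForm (V := E) (W := E)
    (isInvertible_of_posDef (V := E) (g.symm _) (g.pos _) (g.isVonNBounded _))
    (isInvertible_mfderivWithin_extChartAt_symm hy)

theorem contMDiffAt_trivializationAt_inner {x : M} (hx : x ∈ (chartAt H x₀).source) :
    ContMDiffAt I 𝓘(ℝ, E →L[ℝ] E →L[ℝ] ℝ) ∞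
      (fun x : M ↦ (trivializationAt (E →L[ℝ] E →L[ℝ] ℝ)
        (fun x : M ↦ TangentSpace I x →L[ℝ] TangentSpace I x →L[ℝ] ℝ) x₀ ⟨x, g.inner x⟩).2) x := by
  have (x : M) : ContinuousAdd (TangentSpace I x →L[ℝ] ℝ) :=
    inferInstanceAs (ContinuousAdd (E →L[ℝ] ℝ))
  refine (Trivialization.contMDiffAt_section_iff _ ?_).1 (g.contMDiff x)
  exact ⟨hx, hx, trivial⟩

theorem contDiffAt_chartMetric [I.Boundaryless] (hy : y ∈ (extChartAt I x₀).target) :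
    ContDiffAt ℝ ∞ (chartMetric g x₀) y := by
  have hsource {z : E} (hz : z ∈ (extChartAt I x₀).target) :
      (extChartAt I x₀).symm z ∈ (chartAt H x₀).source := by
    simpa using (extChartAt I x₀).map_target hz
  have htarget := (isOpen_extChartAt_target x₀).mem_nhds hy
  have hsymm : ContMDiffAt 𝓘(ℝ, E) I ∞ (extChartAt I x₀).symm y :=
    (contMDiffOn_extChartAt_symm x₀).contMDiffAt htarget
  refine ((contMDiffAt_trivializationAt_inner g x₀ (hsource hy)).comp y
    hsymm).contDiffAt.congr_of_eventuallyEq ?_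
  filter_upwards [htarget] with z hz
  refine ContinuousLinearMap.ext fun u ↦ ContinuousLinearMap.ext fun v ↦ ?_
  have htriv := trivializationAt_form_apply x₀ _ (hsource hz)
    (g.inner ((extChartAt I x₀).symm z)) u v
  rw [(extChartAt I x₀).right_inv hz] at htriv
  exact htriv.symm

theorem isNondegMetricAt_chartMetric [CompleteSpace E] [I.Boundaryless]
    (hy : y ∈ (extChartAt I x₀).target) : IsNondegMetricAt ∞ (chartMetric g x₀) y :=
  ⟨contDiffAt_chartMetric g x₀ hy, isInvertible_chartMetric g x₀ hy⟩

end MetricsInCharts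

/-! ## Maps into Riemannian products -/

section ProductCharts

variable {F₁ : Type*} [NormedAddCommGroup F₁] [NormedSpace ℝ F₁]
  {H₁ : Type*} [TopologicalSpace H₁] {J₁ : ModelWithCorners ℝ F₁ H₁}
  {N₁ : Type*} [TopologicalSpace N₁] [ChartedSpace H₁ N₁] [IsManifold J₁ ∞ N₁]
  {F₂ : Type*} [NormedAddCommGroup F₂] [NormedSpace ℝ F₂]
  {H₂ : Type*} [TopologicalSpace H₂] {J₂ : ModelWithCorners ℝ F₂ H₂}
  {N₂ : Type*} [TopologicalSpace N₂] [ChartedSpace H₂ N₂] [IsManifold J₂ ∞ N₂]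
  {h₁ : ContMDiffRiemannianMetric J₁ ∞ F₁ (TangentSpace J₁ : N₁ → Type _)}
  {h₂ : ContMDiffRiemannianMetric J₂ ∞ F₂ (TangentSpace J₂ : N₂ → Type _)}
  {p₀ : N₁ × N₂} {z : F₁ × F₂}

theorem chartMetric_prodMetric (hz : z ∈ (extChartAt (J₁.prod J₂) p₀).target) :
    chartMetric (prodMetric h₁ h₂) p₀ z =
      prodForm (chartMetric h₁ p₀.1 z.1) (chartMetric h₂ p₀.2 z.2) := by
  have hsymm : (extChartAt (J₁.prod J₂) p₀).symm z =
      ((extChartAt J₁ p₀.1).symm z.1, (extChartAt J₂ p₀.2).symm z.2) := by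
    rw [extChartAt_prod]
    rfl
  let D : F₁ × F₂ →L[ℝ] F₁ × F₂ := mfderivWithin 𝓘(ℝ, F₁ × F₂) (J₁.prod J₂)
    (extChartAt (J₁.prod J₂) p₀).symm (Set.range (J₁.prod J₂)) z
  have hD (w : F₁ × F₂) : D w =
      (mfderivWithin 𝓘(ℝ, F₁) J₁ (extChartAt J₁ p₀.1).symm (Set.range J₁) z.1 w.1,
        mfderivWithin 𝓘(ℝ, F₂) J₂ (extChartAt J₂ p₀.2).symm (Set.range J₂) z.2 w.2) :=
    mfderivWithin_extChartAt_symm_prod p₀ hz w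
  refine ContinuousLinearMap.ext fun u ↦ ContinuousLinearMap.ext fun v ↦
    (prodInner_apply h₁ h₂ _ (D u) (D v)).trans ?_
  rw [hD, hD, hsymm]
  rfl

theorem christoffel_chartMetric_prodMetric [CompleteSpace F₁] [CompleteSpace F₂]
    [J₁.Boundaryless] [J₂.Boundaryless] (hz : z ∈ (extChartAt (J₁.prod J₂) p₀).target)
    (u v : F₁ × F₂) :
    christoffel (chartMetric (prodMetric h₁ h₂) p₀) z u v =
      (christoffel (chartMetric h₁ p₀.1) z.1 u.1 v.1,
        christoffel (chartMetric h₂ p₀.2) z.2 u.2 v.2) := by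
  have hz' := extChartAt_prod (I := J₁) (I' := J₂) p₀ ▸ hz
  have hprod : chartMetric (prodMetric h₁ h₂) p₀ =ᶠ[𝓝 z]
      fun w ↦ prodForm (chartMetric h₁ p₀.1 w.1) (chartMetric h₂ p₀.2 w.2) := by
    filter_upwards [(isOpen_extChartAt_target p₀).mem_nhds hz] with w hw
    exact chartMetric_prodMetric hw
  rw [christoffel_congr hprod,
    christoffel_prodForm ((isNondegMetricAt_chartMetric h₁ p₀.1 hz'.1).of_le (by simp))
      ((isNondegMetricAt_chartMetric h₂ p₀.2 hz'.2).of_le (by simp))]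

theorem isAffineAt_fst_prodMetric [CompleteSpace F₁] [CompleteSpace F₂]
    [J₁.Boundaryless] [J₂.Boundaryless] (hz : z ∈ (extChartAt (J₁.prod J₂) p₀).target) :
    IsAffineAt (.fst ℝ F₁ F₂) (chartMetric (prodMetric h₁ h₂) p₀) (chartMetric h₁ p₀.1) z :=
  fun u v ↦ congrArg Prod.fst (christoffel_chartMetric_prodMetric hz u v)

theorem isAffineAt_snd_prodMetric [CompleteSpace F₁] [CompleteSpace F₂]
    [J₁.Boundaryless] [J₂.Boundaryless] (hz : z ∈ (extChartAt (J₁.prod J₂) p₀).target) :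
    IsAffineAt (.snd ℝ F₁ F₂) (chartMetric (prodMetric h₁ h₂) p₀) (chartMetric h₂ p₀.2) z :=
  fun u v ↦ congrArg Prod.snd (christoffel_chartMetric_prodMetric hz u v)

end ProductCharts

section MapsIntoProducts

variable {E : Type*} [NormedAddCommGroup E] [NormedSpace ℝ E] [FiniteDimensional ℝ E]
  {H : Type*} [TopologicalSpace H] {I : ModelWithCorners ℝ E H}
  {M : Type*} [TopologicalSpace M] [ChartedSpace H M] [IsManifold I ∞ M]
  {F₁ : Type*} [NormedAddCommGroup F₁] [NormedSpace ℝ F₁]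
  {H₁ : Type*} [TopologicalSpace H₁] {J₁ : ModelWithCorners ℝ F₁ H₁}
  {N₁ : Type*} [TopologicalSpace N₁] [ChartedSpace H₁ N₁] [IsManifold J₁ ∞ N₁]
  {F₂ : Type*} [NormedAddCommGroup F₂] [NormedSpace ℝ F₂]
  {H₂ : Type*} [TopologicalSpace H₂] {J₂ : ModelWithCorners ℝ F₂ H₂}
  {N₂ : Type*} [TopologicalSpace N₂] [ChartedSpace H₂ N₂] [IsManifold J₂ ∞ N₂]
  {g : ContMDiffRiemannianMetric I ∞ E (TangentSpace I : M → Type _)}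
  {h₁ : ContMDiffRiemannianMetric J₁ ∞ F₁ (TangentSpace J₁ : N₁ → Type _)}
  {h₂ : ContMDiffRiemannianMetric J₂ ∞ F₂ (TangentSpace J₂ : N₂ → Type _)}
  {φ : M → N₁} {ψ : M → N₂}

theorem IsHarmonic.isBiharmonic (hφ : IsHarmonic g h₁ φ) : IsBiharmonic g h₁ φ := fun x₀ ↦ by
  filter_upwards [(hφ x₀).eventually_nhds] with y hy
  exact localBitension_eq_zero hy

variable [I.Boundaryless] [J₁.Boundaryless] [J₂.Boundaryless]
  [CompleteSpace F₁] [CompleteSpace F₂]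

theorem eventually_tensionInChart_prodMk (hφ : ContMDiff I J₁ 2 φ) (hψ : ContMDiff I J₂ 2 ψ)
    (x₀ : M) : ∀ᶠ y in 𝓝 (extChartAt I x₀ x₀),
      tensionInChart g (prodMetric h₁ h₂) (fun x ↦ (φ x, ψ x)) x₀ y =
        (tensionInChart g h₁ φ x₀ y, tensionInChart g h₂ ψ x₀ y) := by
  have hχ := hφ.prodMk hψ
  filter_upwards [eventually_contDiffAt_writtenInExtChartAt hχ x₀,
    eventually_writtenInExtChartAt_mem_target (J := J₁.prod J₂)
      hχ.continuous.continuousAt] with y hy hz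
  have hfst := map_localTension (G := chartMetric g x₀)
    (isAffineAt_fst_prodMetric (h₁ := h₁) (h₂ := h₂) hz) hy
  have hsnd := map_localTension (G := chartMetric g x₀)
    (isAffineAt_snd_prodMetric (h₁ := h₁) (h₂ := h₂) hz) hy
  simp only [writtenInExtChartAt_prodMk] at hfst hsnd
  simp only [tensionInChart, writtenInExtChartAt_prodMk]
  exact Prod.ext hfst.symm hsnd.symm

theorem eventually_bitensionInChart_prodMk (hφ : ContMDiff I J₁ 4 φ) (hψ : ContMDiff I J₂ 4 ψ)
    (x₀ : M) : ∀ᶠ y in 𝓝 (extChartAt I x₀ x₀),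
      bitensionInChart g (prodMetric h₁ h₂) (fun x ↦ (φ x, ψ x)) x₀ y =
        (bitensionInChart g h₁ φ x₀ y, bitensionInChart g h₂ ψ x₀ y) := by
  have : CompleteSpace E := FiniteDimensional.complete ℝ E
  have hχ := hφ.prodMk hψ
  filter_upwards [eventually_contDiffAt_writtenInExtChartAt hχ x₀,
    eventually_writtenInExtChartAt_mem_target (J := J₁.prod J₂)
      hχ.continuous.continuousAt,
    extChartAt_target_mem_nhds x₀] with y hy hz hyt
  have hz' := extChartAt_prod (I := J₁) (I' := J₂) (φ x₀, ψ x₀) ▸ hz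
  have htarget := (isOpen_extChartAt_target (I := J₁.prod J₂) (φ x₀, ψ x₀)).mem_nhds hz
  have hG := (isNondegMetricAt_chartMetric g x₀ hyt).of_le (m := 3) ENat.LEInfty.out
  have hK := (isNondegMetricAt_chartMetric (prodMetric h₁ h₂) _ hz).of_le (m := 3) ENat.LEInfty.out
  have hfst := map_localBitension
    (Filter.mem_of_superset htarget fun _ hw ↦
      isAffineAt_fst_prodMetric (h₁ := h₁) (h₂ := h₂) hw) hG hK
    ((isNondegMetricAt_chartMetric h₁ _ hz'.1).of_le ENat.LEInfty.out) hy
  have hsnd := map_localBitension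
    (Filter.mem_of_superset htarget fun _ hw ↦
      isAffineAt_snd_prodMetric (h₁ := h₁) (h₂ := h₂) hw) hG hK
    ((isNondegMetricAt_chartMetric h₂ _ hz'.2).of_le ENat.LEInfty.out) hy
  simp only [writtenInExtChartAt_prodMk] at hfst hsnd
  simp only [bitensionInChart, writtenInExtChartAt_prodMk]
  exact Prod.ext hfst.symm hsnd.symm

theorem isHarmonic_prodMk_iff (hφ : ContMDiff I J₁ 2 φ) (hψ : ContMDiff I J₂ 2 ψ) :
    IsHarmonic g (prodMetric h₁ h₂) (fun x ↦ (φ x, ψ x)) ↔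
      IsHarmonic g h₁ φ ∧ IsHarmonic g h₂ ψ := by
  simp only [IsHarmonic, ← forall_and, ← Filter.eventually_and]
  refine forall_congr' fun x₀ ↦ Filter.eventually_congr ?_
  filter_upwards [eventually_tensionInChart_prodMk hφ hψ x₀] with y hy
  rw [hy, Prod.mk_eq_zero]

theorem isBiharmonic_prodMk_iff (hφ : ContMDiff I J₁ 4 φ) (hψ : ContMDiff I J₂ 4 ψ) :
    IsBiharmonic g (prodMetric h₁ h₂) (fun x ↦ (φ x, ψ x)) ↔
      IsBiharmonic g h₁ φ ∧ IsBiharmonic g h₂ ψ := by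
  simp only [IsBiharmonic, ← forall_and, ← Filter.eventually_and]
  refine forall_congr' fun x₀ ↦ Filter.eventually_congr ?_
  filter_upwards [eventually_bitensionInChart_prodMk hφ hψ x₀] with y hy
  rw [hy, Prod.mk_eq_zero]

end MapsIntoProducts

end BiharmonicMaps

open BiharmonicMaps in
theorem theorem3p3_general
    {E : Type*} [NormedAddCommGroup E] [NormedSpace ℝ E] [FiniteDimensional ℝ E]
    {H : Type*} [TopologicalSpace H] {I : ModelWithCorners ℝ E H} [I.Boundaryless]
    {M : Type*} [TopologicalSpace M] [ChartedSpace H M] [IsManifold I ∞ M]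
    {F₁ : Type*} [NormedAddCommGroup F₁] [NormedSpace ℝ F₁] [CompleteSpace F₁]
    {H₁ : Type*} [TopologicalSpace H₁] {J₁ : ModelWithCorners ℝ F₁ H₁} [J₁.Boundaryless]
    {N₁ : Type*} [TopologicalSpace N₁] [ChartedSpace H₁ N₁] [IsManifold J₁ ∞ N₁]
    {F₂ : Type*} [NormedAddCommGroup F₂] [NormedSpace ℝ F₂] [CompleteSpace F₂]
    {H₂ : Type*} [TopologicalSpace H₂] {J₂ : ModelWithCorners ℝ F₂ H₂} [J₂.Boundaryless]
    {N₂ : Type*} [TopologicalSpace N₂] [ChartedSpace H₂ N₂] [IsManifold J₂ ∞ N₂]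
    (g : ContMDiffRiemannianMetric I ∞ E (TangentSpace I : M → Type _))
    (h₁ : ContMDiffRiemannianMetric J₁ ∞ F₁ (TangentSpace J₁ : N₁ → Type _))
    (h₂ : ContMDiffRiemannianMetric J₂ ∞ F₂ (TangentSpace J₂ : N₂ → Type _))
    (φ : M → N₁) (hφ : ContMDiff I J₁ 4 φ) (ψ : M → N₂) (hψ : ContMDiff I J₂ 4 ψ) :
    (IsBiharmonic g (prodMetric h₁ h₂) (fun x ↦ (φ x, ψ x)) ↔
      IsBiharmonic g h₁ φ ∧ IsBiharmonic g h₂ ψ) ∧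
    ((IsHarmonic g h₁ φ ∧ IsProperBiharmonic g h₂ ψ) ∨
        (IsProperBiharmonic g h₁ φ ∧ IsHarmonic g h₂ ψ) →
      IsProperBiharmonic g (prodMetric h₁ h₂) (fun x ↦ (φ x, ψ x))) := by
  have hb := isBiharmonic_prodMk_iff (g := g) (h₁ := h₁) (h₂ := h₂) hφ hψ
  have hh := isHarmonic_prodMk_iff (g := g) (h₁ := h₁) (h₂ := h₂)
    (hφ.of_le (by norm_num)) (hψ.of_le (by norm_num))
  refine ⟨hb, ?_⟩
  rintro (⟨hφ₀, hψ₂, hψ₁⟩ | ⟨⟨hφ₂, hφ₁⟩, hψ₀⟩)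
  · exact ⟨hb.2 ⟨hφ₀.isBiharmonic, hψ₂⟩, fun h ↦ hψ₁ (hh.1 h).2⟩
  · exact ⟨hb.2 ⟨hφ₂, hψ₀.isBiharmonic⟩, fun h ↦ hφ₁ (hh.1 h).1⟩

open BiharmonicMaps in
theorem theorem3p3
    {E : Type*} [NormedAddCommGroup E] [NormedSpace ℝ E] [FiniteDimensional ℝ E]
    {H : Type*} [TopologicalSpace H] {I : ModelWithCorners ℝ E H} [I.Boundaryless]
    {M : Type*} [TopologicalSpace M] [ChartedSpace H M] [IsManifold I ∞ M]
    {F₁ : Type*} [NormedAddCommGroup F₁] [NormedSpace ℝ F₁] [FiniteDimensional ℝ F₁]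
    {H₁ : Type*} [TopologicalSpace H₁] {J₁ : ModelWithCorners ℝ F₁ H₁} [J₁.Boundaryless]
    {N₁ : Type*} [TopologicalSpace N₁] [ChartedSpace H₁ N₁] [IsManifold J₁ ∞ N₁]
    {F₂ : Type*} [NormedAddCommGroup F₂] [NormedSpace ℝ F₂] [FiniteDimensional ℝ F₂]
    {H₂ : Type*} [TopologicalSpace H₂] {J₂ : ModelWithCorners ℝ F₂ H₂} [J₂.Boundaryless]
    {N₂ : Type*} [TopologicalSpace N₂] [ChartedSpace H₂ N₂] [IsManifold J₂ ∞ N₂]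
    (g : Bundle.ContMDiffRiemannianMetric I ∞ E (TangentSpace I : M → Type _))
    (h₁ : Bundle.ContMDiffRiemannianMetric J₁ ∞ F₁ (TangentSpace J₁ : N₁ → Type _))
    (h₂ : Bundle.ContMDiffRiemannianMetric J₂ ∞ F₂ (TangentSpace J₂ : N₂ → Type _))
    (φ : M → N₁) (hφ : ContMDiff I J₁ ∞ φ) (ψ : M → N₂) (hψ : ContMDiff I J₂ ∞ ψ) :
    (IsBiharmonic g (prodMetric h₁ h₂) (fun x ↦ (φ x, ψ x)) ↔
      IsBiharmonic g h₁ φ ∧ IsBiharmonic g h₂ ψ) ∧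
    ((IsHarmonic g h₁ φ ∧ IsProperBiharmonic g h₂ ψ) ∨
        (IsProperBiharmonic g h₁ φ ∧ IsHarmonic g h₂ ψ) →
      IsProperBiharmonic g (prodMetric h₁ h₂) (fun x ↦ (φ x, ψ x))) := by
  have : CompleteSpace F₁ := FiniteDimensional.complete ℝ F₁
  have : CompleteSpace F₂ := FiniteDimensional.complete ℝ F₂
  exact theorem3p3_general g h₁ h₂ φ (hφ.of_le ENat.LEInfty.out) ψ (hψ.of_le ENat.LEInfty.out)
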